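/- Let $R$ be a finite chain ring of nilpotency index two, i.e. a finite associative ring with $1$, not necessarily commutative, whose left ideals form a chain and whose right ideals form a chain, and whose radical $\operatorname{rad} R$ satisfies $\operatorname{rad} R\neq 0$ and $(\operatorname{rad} R)^2=0$. Let $q=|R/\operatorname{rad} R|$ be the order of its residue field. The right projective Hjelmslev plane $\mathrm{PHG}(2,R)$ has as points and as lines the free submodules of rank $1$ and of rank $2$, respectively, of the free right module $R^3_R$, and incidence is inclusion. Two points are neighbours if they have the same image in $(R/\operatorname{rad} R)^3$ under the coordinatewise projection; the classes of this equivalence relation are the neighbour classes of points. For a multiset of points, i.e. a function $\mathfrak K$ from the points to the nonnegative integers, and a set $S$ of points put $\mathfrak K(S)=\sum_{x\in S}\mathfrak K(x)$. The multiset $\mathfrak K$ is a $(k,n)$-arc if the set $\mathcal P$ of all points satisfies $\mathfrak K(\mathcal P)=k$ and every line $L$, viewed as a set of points, satisfies $\mathfrak K(L)\le n$. Let $\mathfrak K$ be a $(k,n)$-arc in $\mathrm{PHG}(2,R)$. 1. If $q^2-q+1\le n\le q^2-1$, then $k\le q(q+1)n-q^3+q^2-q$. 2. If $n=q^2-q$,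 then $k\le q^4-q^3-q+1$, and if equality holds, then $\mathfrak K([x])=(q-1)^2$ for every neighbour class $[x]$ of points. -/

import Mathlib

namespace Hjelmslev

/-- `R` is a chain ring of nilpotency index two: the left ideals form a chain, the right ideals
form a chain, and the radical is nonzero with square zero. -/
structure IsChainRingOfLengthTwo (R : Type*) [Ring R] : Prop where
  left_total : ∀ I J : Submodule R R, I ≤ J ∨ J ≤ I
  right_total : ∀ I J : Submodule Rᵐᵒᵖ R, I ≤ J ∨ J ≤ I
  radical_ne_bot : Ring.jacobson R ≠ ⊥
  radical_sq : ∀ a ∈ Ring.jacobson R, ∀ b ∈ Ring.jacobson R, a * b = 0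

/-- The free submodules of rank `r` of the free right `R`-module of rank `3`
(a right `R`-module is a module over the opposite ring). -/
def FreeSubmodule (R : Type*) [Ring R] (r : ℕ) : Type _ :=
  {M : Submodule Rᵐᵒᵖ (Fin 3 → R) // Nonempty (Module.Basis (Fin r) Rᵐᵒᵖ M)}

/-- Points of the right projective Hjelmslev plane over `R`. -/
abbrev Point (R : Type*) [Ring R] : Type _ := FreeSubmodule R 1

/-- Lines of the right projective Hjelmslev plane over `R`. -/
abbrev Line (R : Type*) [Ring R] : Type _ := FreeSubmodule R 2

instance (R : Type*) [Ring R] [Finite R] (r : ℕ) : Finite (FreeSubmodule R r) :=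
  inferInstanceAs (Finite {M : Submodule Rᵐᵒᵖ (Fin 3 → R) // _})

/-- The set of points incident with a line. -/
def Line.points {R : Type*} [Ring R] (L : Line R) : Set (Point R) :=
  {x | x.1 ≤ L.1}

/-- The coordinatewise projection of `R ^ 3` onto `(R / rad R) ^ 3`. -/
def residue (R : Type*) [Ring R] (v : Fin 3 → R) : Fin 3 → R ⧸ Ring.jacobson R :=
  fun i => Ideal.Quotient.mk (Ring.jacobson R) (v i)

/-- The neighbour class of the point `x`: all points whose image in `(R / rad R) ^ 3` is the
image of `x`. -/
def neighbourClass {R : Type*} [Ring R] (x : Point R) : Set (Point R) :=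
  {y | residue R '' (y.1 : Set (Fin 3 → R)) = residue R '' (x.1 : Set (Fin 3 → R))}

/-- The multiplicity of a set `S` of points in the multiset `K` of points. -/
noncomputable def mult {R : Type*} [Ring R] (K : Point R → ℕ) (S : Set (Point R)) : ℕ :=
  ∑ᶠ x ∈ S, K x

/-- The multiset `K` of points is a `(k, n)`-arc: it has cardinality `k`, and every line has
multiplicity at most `n`. -/
def IsArc {R : Type*} [Ring R] (K : Point R → ℕ) (k n : ℕ) : Prop :=
  mult K Set.univ = k ∧ ∀ L : Line R, mult K L.points ≤ n

end Hjelmslev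

/-! Let u be the multiplicity of a neighbour class C = [x]. Since the radical is a copy of the
residue field F with square zero, C is an affine plane of order q: a line meeting C cuts out an
affine line, and the q lifts to R of a residue slope, with the intercept fixed, cut out the same
one. Those q lines together cover all points outside C lying in that direction. Choosing one affine
line in each of the q + 1 directions, of total multiplicity s, therefore gives q(q+1) lines covering
the complement of C, so k ≤ u + q(q+1)n - qs.

Suppose u > (q-1)^2 and take the heaviest affine line in each direction. If u ≥ q^2-q+1, averaging
gives qs ≥ (q+1)u, which suffices. Otherwise every chosen line has at least q-1 points, and one of
them has at least q, so s ≥ q^2. This extra point comes from Jamison's theorem: if all lines had at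
most q-1 points, then either a multiple point makes u too small, or the complement is a blocking set
of at least 2q-1 points (`exists_lines_of_large`, `exists_card_le_line`).

If every class has at most (q-1)^2 points, summing over at most q^2+q+1 classes (`exists_classes`)
gives k ≤ q^4-q^3-q+1, and equality makes every class tight. -/

namespace Hjelmslev

/-! ### Multisets in the affine plane and Jamison's theorem -/

section Affine

variable {F : Type*} [Field F] [Fintype F]

/-- A set of nonzero vectors meeting every line `c 0 * x + c 1 * y = 1` has at least `2 (q - 1)`
elements. -/
theorem two_mul_card_sub_one_le_of_meets [DecidableEq F] (B : Finset (F × F))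
    (h : ∀ c : Fin 2 → F, c ≠ 0 → ∃ b ∈ B, c 0 * b.1 + c 1 * b.2 = 1) :
    (Fintype.card F - 1) * 2 ≤ B.card := by
  by_contra! hlt
  -- P vanishes at every nonzero c and P(0) = ±1, so its values sum to ±1. A degree below 2(q-1)
  -- would make that sum zero, as in Chevalley–Warning.
  let P : MvPolynomial (Fin 2) F :=
    ∏ b ∈ B, (MvPolynomial.X 0 * MvPolynomial.C b.1 + MvPolynomial.X 1 * MvPolynomial.C b.2 - 1)
  have hfac : ∀ b : F × F, (MvPolynomial.X 0 * MvPolynomial.C b.1 +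
      MvPolynomial.X 1 * MvPolynomial.C b.2 - 1 : MvPolynomial (Fin 2) F).totalDegree ≤ 1 := by
    intro b
    have hX : ∀ (i : Fin 2) (a : F),
        (MvPolynomial.X i * MvPolynomial.C a : MvPolynomial (Fin 2) F).totalDegree ≤ 1 := by
      intro i a
      refine (MvPolynomial.totalDegree_mul _ _).trans ?_
      simp
    refine (MvPolynomial.totalDegree_sub _ _).trans (max_le ?_ (by simp))
    exact (MvPolynomial.totalDegree_add _ _).trans (max_le (hX _ _) (hX _ _))
  have hdeg : P.totalDegree ≤ B.card := by
    refine (MvPolynomial.totalDegree_finsetProd _ _).trans ?_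
    refine (Finset.sum_le_sum fun b _ => hfac b).trans ?_
    simp
  have hsum : ∑ c : Fin 2 → F, MvPolynomial.eval c P = 0 :=
    MvPolynomial.sum_eval_eq_zero P (by simpa using hdeg.trans_lt hlt)
  have heval : ∀ c : Fin 2 → F,
      MvPolynomial.eval c P = ∏ b ∈ B, (c 0 * b.1 + c 1 * b.2 - 1) := by
    intro c
    simp [P, map_prod]
  rw [Finset.sum_eq_single (0 : Fin 2 → F)] at hsum
  · rw [heval] at hsum
    simp at hsum
  · intro c _ hc
    obtain ⟨b, hb, hbc⟩ := h c hc
    rw [heval]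
    exact Finset.prod_eq_zero hb (by rw [hbc, sub_self])
  · simp

/-- Jamison's theorem: a set of points of the affine plane over a field of order `q` that meets
every line has at least `2 q - 1` points. -/
theorem two_mul_card_le_of_meets_lines [DecidableEq F] (B : Finset (F × F))
    (hslope : ∀ m a : F, ∃ s, (s, a + m * s) ∈ B) (hvert : ∀ a : F, ∃ t, (a, t) ∈ B) :
    2 * Fintype.card F ≤ B.card + 1 := by
  obtain ⟨t₀, ht₀⟩ := hvert 0
  have hq : 0 < Fintype.card F := Fintype.card_pos
  -- Move a point of B to the origin and delete it: the remaining points still meet every line that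
  -- misses the origin.
  have key := two_mul_card_sub_one_le_of_meets
    ((B.erase (0, t₀)).image fun b => (b.1, b.2 - t₀)) ?_
  · have h1 := Finset.card_image_le (s := B.erase (0, t₀)) (f := fun b => (b.1, b.2 - t₀))
    rw [Finset.card_erase_of_mem ht₀] at h1
    have : 0 < B.card := Finset.card_pos.2 ⟨_, ht₀⟩
    omega
  · intro c hc
    have main : ∃ b ∈ B, c 0 * b.1 + c 1 * (b.2 - t₀) = 1 := by
      by_cases h1 : c 1 = 0
      · have h0 : c 0 ≠ 0 := by
          intro h0
          exact hc (funext fun i => by fin_cases i <;> simp [h0, h1])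
        obtain ⟨t, ht⟩ := hvert (c 0)⁻¹
        exact ⟨_, ht, by simp [h1, h0]⟩
      · obtain ⟨s, hs⟩ := hslope (-(c 0 / c 1)) (t₀ + (c 1)⁻¹)
        refine ⟨_, hs, ?_⟩
        field_simp
        ring
    obtain ⟨b, hb, hbc⟩ := main
    refine ⟨(b.1, b.2 - t₀), Finset.mem_image.2 ⟨b, Finset.mem_erase.2 ⟨?_, hb⟩, rfl⟩, hbc⟩
    rintro rfl
    simp at hbc

/-- The multiplicity of the line of slope `m` and intercept `a`. -/
def slopeSum (f : F → F → ℕ) (m a : F) : ℕ := ∑ s, f s (a + m * s)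

/-- The multiplicity of the vertical line through `(a, 0)`. -/
def vertSum (f : F → F → ℕ) (a : F) : ℕ := ∑ t, f a t

theorem sum_slopeSum (f : F → F → ℕ) (m : F) : ∑ a, slopeSum f m a = ∑ s, ∑ t, f s t := by
  unfold slopeSum
  rw [Finset.sum_comm]
  exact Finset.sum_congr rfl fun s _ => Equiv.sum_comp (Equiv.addRight (m * s)) (f s)

/-- The sum of the multiplicities of the lines through a point. -/
theorem sum_lines_through [DecidableEq F] (f : F → F → ℕ) (x y : F) :
    ∑ m, slopeSum f m (y - m * x) + vertSum f x =
      ∑ s, ∑ t, f s t + Fintype.card F * f x y := by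
  -- The non-vertical lines through (x, y) meet each other column once per point, and column x
  -- always in (x, y).
  have h : ∀ s, ∑ m, f s (y - m * x + m * s) =
      if s = x then Fintype.card F * f x y else ∑ t, f s t := by
    intro s
    split_ifs with hs
    · subst hs
      simp
    · rw [← Equiv.sum_comp ((Equiv.mulRight₀ (s - x) (sub_ne_zero.2 hs)).trans (Equiv.addLeft y))
        (f s)]
      refine Finset.sum_congr rfl fun m _ => congrArg (f s) ?_
      simp
      ring
  unfold slopeSum vertSum
  rw [Finset.sum_comm, Finset.sum_congr rfl fun s _ => h s,
    ← Finset.add_sum_erase _ _ (Finset.mem_univ x),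
    ← Finset.add_sum_erase (a := x) _ (fun s => ∑ t, f s t) (Finset.mem_univ x),
    Finset.sum_congr rfl fun s hs => if_neg (Finset.ne_of_mem_erase hs)]
  simp only [if_true]
  ring

/-- A multiset of more than `(q - 1) ^ 2` points of the affine plane has a line of multiplicity at
least `q`. -/
theorem exists_card_le_line (f : F → F → ℕ)
    (hf : ((Fintype.card F : ℤ) - 1) ^ 2 < (∑ s, ∑ t, f s t : ℕ)) :
    (∃ m a, Fintype.card F ≤ slopeSum f m a) ∨ ∃ a, Fintype.card F ≤ vertSum f a := by
  classical
  by_contra! h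
  obtain ⟨hs, hv⟩ := h
  have hq : 2 ≤ Fintype.card F := Fintype.one_lt_card
  by_cases hmul : ∃ x y, 2 ≤ f x y
  -- The q + 1 lines through a multiple point would give u + 2q ≤ (q+1)(q-1), so u < (q-1)^2.
  · obtain ⟨x, y, hxy⟩ := hmul
    have h1 := sum_lines_through f x y
    have h2 : ∑ m, slopeSum f m (y - m * x) ≤ ∑ _m : F, (Fintype.card F - 1) :=
      Finset.sum_le_sum fun m _ => Nat.le_sub_one_of_lt (hs m _)
    have h3 := hv x
    simp only [Finset.sum_const, Finset.card_univ, smul_eq_mul] at h2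
    zify [Fintype.card_pos (α := F)] at h1 h2 h3 hxy hq hf
    nlinarith
  · push Not at hmul
    let B : Finset (F × F) := Finset.univ.filter fun p => f p.1 p.2 = 0
    have hone : ∀ p : F × F, p ∉ B → f p.1 p.2 = 1 := by
      intro p hp
      have : f p.1 p.2 ≠ 0 := by simpa [B] using hp
      have := hmul p.1 p.2
      omega
    have hB := two_mul_card_le_of_meets_lines B
      (fun m a => by
        by_contra! hc
        refine (hs m a).ne ?_
        simp [slopeSum, fun s => hone _ (hc s)])
      (fun a => by
        by_contra! hc
        refine (hv a).ne ?_
        simp [vertSum, fun t => hone _ (hc t)])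
    have hcount : ∑ s, ∑ t, f s t + B.card = Fintype.card F * Fintype.card F := by
      rw [← Fintype.sum_prod_type', Finset.card_filter, ← Finset.sum_add_distrib,
        ← Fintype.card_prod, ← Finset.card_univ, Finset.card_eq_sum_ones]
      refine Finset.sum_congr rfl fun p _ => ?_
      have := hmul p.1 p.2
      split_ifs <;> omega
    zify at hB hcount hf
    nlinarith

/-- Some choice of one line in every direction makes the lines heavy in total. -/
theorem exists_lines_of_large (f : F → F → ℕ)
    (hf : ((Fintype.card F : ℤ) - 1) ^ 2 < (∑ s, ∑ t, f s t : ℕ)) :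
    ∃ (a : F → F) (b : F), (Fintype.card F : ℤ) ^ 3 - (Fintype.card F : ℤ) ^ 2 + Fintype.card F +
      (∑ s, ∑ t, f s t : ℕ) ≤
        Fintype.card F * ((∑ m, slopeSum f m (a m) : ℕ) + vertSum f b) := by
  have hs := fun m => Finite.exists_max (slopeSum f m)
  choose a ha using hs
  obtain ⟨b, hb⟩ := Finite.exists_max (vertSum f)
  refine ⟨a, b, ?_⟩
  set u : ℕ := ∑ s, ∑ t, f s t with hu
  set q : ℕ := Fintype.card F with hqdef
  have hq : 2 ≤ q := Fintype.one_lt_card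
  have hsu : ∀ m, u ≤ q * slopeSum f m (a m) := by
    intro m
    rw [hu, ← sum_slopeSum f m]
    refine (Finset.sum_le_sum fun x _ => ha m x).trans ?_
    simp [hqdef]
  have hvu : u ≤ q * vertSum f b := by
    refine (Finset.sum_le_sum fun x _ => hb x).trans ?_
    simp [hqdef]
  have hsum : q * u ≤ q * ∑ m, slopeSum f m (a m) := by
    calc q * u = ∑ _m : F, u := by simp [hqdef]
      _ ≤ ∑ m, q * slopeSum f m (a m) := Finset.sum_le_sum fun m _ => hsu m
      _ = _ := (Finset.mul_sum _ _ _).symm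
  by_cases hlarge : (q : ℤ) ^ 2 - q + 1 ≤ u
  · zify at hsum hvu hq
    push_cast
    nlinarith
  -- The average u/q exceeds (q-1)^2/q > q-2, so it rounds up to at least q-1.
  · have hge : ∀ x : ℕ, u ≤ q * x → (q : ℤ) - 1 ≤ x := by
      intro x hx
      zify at hx hq
      by_contra! hlt
      nlinarith
    have hsg := fun m => hge _ (hsu m)
    have hvg := hge _ hvu
    have hcard : ∑ _m : F, ((q : ℤ) - 1) = q * (q - 1) := by
      rw [Finset.sum_const, Finset.card_univ, nsmul_eq_mul]
    have htot : (q : ℤ) ^ 2 ≤ (∑ m, slopeSum f m (a m) : ℕ) + vertSum f b := by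
      push_cast
      obtain ⟨m, x, hmx⟩ | ⟨x, hx⟩ := exists_card_le_line f hf
      · have h1 : ∑ _m : F, ((q : ℤ) - 1) < ∑ m, (slopeSum f m (a m) : ℤ) := by
          refine Finset.sum_lt_sum (fun m _ => hsg m) ⟨m, Finset.mem_univ m, ?_⟩
          have := hmx.trans (ha m x)
          zify at this
          linarith
        rw [hcard] at h1
        nlinarith
      · have h1 : ∑ _m : F, ((q : ℤ) - 1) ≤ ∑ m, (slopeSum f m (a m) : ℤ) :=
          Finset.sum_le_sum fun m _ => hsg m
        have := hx.trans (hb x)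
        zify at this
        rw [hcard] at h1
        nlinarith
    zify at hq
    nlinarith

end Affine

/-! ### Units, residue field and radical of the chain ring -/

section ChainRing

variable {R : Type*} [Ring R]

theorem IsChainRingOfLengthTwo.nontrivial (hR : IsChainRingOfLengthTwo R) : Nontrivial R := by
  by_contra h
  rw [not_nontrivial_iff_subsingleton] at h
  exact hR.radical_ne_bot (Subsingleton.elim _ _)

/-- A chain of left ideals has a single maximal one, which is the radical. So a generates R as a
left ideal, and in a finite ring a left inverse is two-sided. -/
theorem IsChainRingOfLengthTwo.isUnit_of_notMem [Finite R] (hR : IsChainRingOfLengthTwo R) {a : R}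
    (ha : a ∉ Ring.jacobson R) : IsUnit a := by
  have htop : Ideal.span {a} = ⊤ := by
    by_contra hne
    obtain ⟨M, hM, hle⟩ := Ideal.exists_le_maximal _ hne
    refine ha ?_
    rw [Ring.jacobson_eq_sInf_isMaximal]
    refine Submodule.mem_sInf.2 fun I hI => ?_
    have hIM : I = M := by
      rcases hR.left_total I M with h | h
      · exact Ideal.IsMaximal.eq_of_le hI hM.ne_top h
      · exact (Ideal.IsMaximal.eq_of_le hM (Ideal.IsMaximal.ne_top hI) h).symm
    rw [hIM]
    exact hle (Ideal.mem_span_singleton_self a)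
  obtain ⟨b, hb⟩ := Ideal.mem_span_singleton'.1 ((Ideal.eq_top_iff_one _).1 htop)
  exact IsUnit.of_mul_eq_one_right b hb

theorem IsChainRingOfLengthTwo.notMem_of_isUnit (hR : IsChainRingOfLengthTwo R) {a : R}
    (ha : IsUnit a) : a ∉ Ring.jacobson R := by
  intro h
  have := hR.nontrivial
  obtain ⟨u, rfl⟩ := ha
  have h1 := (Ring.jacobson R).mul_mem_left (↑u⁻¹) h
  rw [Units.inv_mul] at h1
  simpa using hR.radical_sq 1 h1 1 h1

theorem IsChainRingOfLengthTwo.isField [Finite R] (hR : IsChainRingOfLengthTwo R) :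
    IsField (R ⧸ Ring.jacobson R) := by
  have := hR.nontrivial
  have hunit : ∀ a : R ⧸ Ring.jacobson R, a ≠ 0 → IsUnit a := by
    intro a ha
    obtain ⟨r, rfl⟩ := Ideal.Quotient.mk_surjective a
    rw [Ne, Ideal.Quotient.eq_zero_iff_mem] at ha
    exact (hR.isUnit_of_notMem ha).map _
  have hnt : Nontrivial (R ⧸ Ring.jacobson R) := by
    refine ⟨1, 0, fun h => ?_⟩
    rw [← map_one (Ideal.Quotient.mk (Ring.jacobson R)), Ideal.Quotient.eq_zero_iff_mem] at h
    exact hR.notMem_of_isUnit isUnit_one h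
  have hdiv : NoZeroDivisors (R ⧸ Ring.jacobson R) := by
    refine ⟨fun {a b} hab => ?_⟩
    by_contra! h
    obtain ⟨ha, hb⟩ := h
    exact hb ((hunit a ha).mul_right_eq_zero.1 hab)
  have : IsDomain (R ⧸ Ring.jacobson R) := NoZeroDivisors.to_isDomain _
  have : Finite (R ⧸ Ring.jacobson R) := Finite.of_surjective _ Ideal.Quotient.mk_surjective
  -- Commutativity of the residue ring is Wedderburn's little theorem.
  exact Finite.isDomain_to_isField _

/-- The radical is isomorphic, as a left module, to the residue field. -/
theorem IsChainRingOfLengthTwo.exists_residue_equiv_radical [Finite R] (hR : IsChainRingOfLengthTwo R) :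
    ∃ j : (R ⧸ Ring.jacobson R) → R, Function.Injective j ∧
      (∀ a, a ∈ Ring.jacobson R ↔ ∃ c, j c = a) ∧
      ∀ (a s : R ⧸ Ring.jacobson R) (m : R),
        j (a + Ideal.Quotient.mk _ m * s) = j a + m * j s := by
  obtain ⟨θ, hθ, hθ0⟩ := (Submodule.ne_bot_iff _).1 hR.radical_ne_bot
  have hann : ∀ r : R, r * θ = 0 ↔ r ∈ Ring.jacobson R := by
    refine fun r => ⟨fun h => ?_, fun h => hR.radical_sq r h θ hθ⟩
    by_contra hr
    exact hθ0 ((hR.isUnit_of_notMem hr).mul_right_eq_zero.1 h)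
  have hgen : ∀ a ∈ Ring.jacobson R, ∃ r, r * θ = a := by
    intro a ha
    rcases hR.left_total (Ideal.span {a}) (Ideal.span {θ}) with h | h
    · exact Ideal.mem_span_singleton'.1 (h (Ideal.mem_span_singleton_self a))
    · obtain ⟨r, hr⟩ := Ideal.mem_span_singleton'.1 (h (Ideal.mem_span_singleton_self θ))
      have hru : r ∉ Ring.jacobson R := fun hrJ => hθ0 (by rw [← hr, hR.radical_sq r hrJ a ha])
      obtain ⟨u, rfl⟩ := hR.isUnit_of_notMem hru
      exact ⟨↑u⁻¹, by rw [← hr, Units.inv_mul_cancel_left]⟩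
  -- Right multiplication by a generator θ of the radical; its kernel is the radical. Left linearity
  -- matches the left coefficients in line equations.
  let j : (R ⧸ Ring.jacobson R) →ₗ[R] R :=
    (Ring.jacobson R).liftQ (LinearMap.toSpanSingleton R R θ) fun r hr => by
      simpa using (hann r).2 hr
  have hj : ∀ r : R, j (Ideal.Quotient.mk _ r) = r * θ := fun r => rfl
  refine ⟨j, ?_, fun a => ⟨fun ha => ?_, ?_⟩, fun a s m => ?_⟩
  · rw [injective_iff_map_eq_zero]
    intro c hc
    obtain ⟨r, rfl⟩ := Ideal.Quotient.mk_surjective c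
    rw [hj, hann] at hc
    exact Ideal.Quotient.eq_zero_iff_mem.2 hc
  · obtain ⟨r, rfl⟩ := hgen a ha
    exact ⟨_, hj r⟩
  · rintro ⟨c, rfl⟩
    obtain ⟨r, rfl⟩ := Ideal.Quotient.mk_surjective c
    rw [hj]
    exact (Ring.jacobson R).mul_mem_left r hθ
  · obtain ⟨a, rfl⟩ := Ideal.Quotient.mk_surjective a
    obtain ⟨s, rfl⟩ := Ideal.Quotient.mk_surjective s
    rw [← map_mul, ← map_add, hj, hj, hj, add_mul, mul_assoc]

end ChainRing

/-! ### Coordinates for points, lines and neighbour classes -/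

section Geometry

open MulOpposite

variable {R : Type*} [Ring R]

/-- The elements of a right module annihilated by the radical. -/
def IsRad {M : Type*} [AddCommGroup M] [Module Rᵐᵒᵖ M] (w : M) : Prop :=
  ∀ a ∈ Ring.jacobson R, op a • w = 0

/-- Having all coordinates in the radical is expressed by annihilation so that it is visibly
independent of the frame. -/
theorem isRad_map_iff {M N : Type*} [AddCommGroup M] [Module Rᵐᵒᵖ M] [AddCommGroup N]
    [Module Rᵐᵒᵖ N] (φ : M ≃ₗ[Rᵐᵒᵖ] N) (w : M) : IsRad (R := R) (φ w) ↔ IsRad (R := R) w :=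
  forall₂_congr fun a _ => by rw [← map_smul, φ.map_eq_zero_iff]

theorem IsRad.smul {M : Type*} [AddCommGroup M] [Module Rᵐᵒᵖ M] {w : M}
    (h : IsRad (R := R) w) (c : Rᵐᵒᵖ) : IsRad (R := R) (c • w) := by
  intro a ha
  have := h _ ((Ring.jacobson R).mul_mem_left c.unop ha)
  rwa [op_mul, op_unop, mul_smul] at this

theorem isRad_sub_comm {M : Type*} [AddCommGroup M] [Module Rᵐᵒᵖ M] {v w : M}
    (h : IsRad (R := R) (v - w)) : IsRad (R := R) (w - v) := by
  intro a ha
  rw [← neg_sub, smul_neg, h a ha, neg_zero]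

variable [Finite R]

theorem isRad_ring_iff (hR : IsChainRingOfLengthTwo R) (r : R) :
    IsRad (R := R) r ↔ r ∈ Ring.jacobson R := by
  refine ⟨fun h => ?_, fun h a ha => hR.radical_sq r h a ha⟩
  by_contra hr
  obtain ⟨θ, hθ, hθ0⟩ := (Submodule.ne_bot_iff _).1 hR.radical_ne_bot
  exact hθ0 ((hR.isUnit_of_notMem hr).mul_right_eq_zero.1 (h θ hθ))

theorem isRad_prod_iff (hR : IsChainRingOfLengthTwo R) (z : R × R × R) :
    IsRad (R := R) z ↔
      z.1 ∈ Ring.jacobson R ∧ z.2.1 ∈ Ring.jacobson R ∧ z.2.2 ∈ Ring.jacobson R := by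
  simp_rw [← isRad_ring_iff hR]
  exact ⟨fun h => ⟨fun a ha => congrArg Prod.fst (h a ha),
    fun a ha => congrArg (fun y => y.2.1) (h a ha), fun a ha => congrArg (fun y => y.2.2) (h a ha)⟩,
    fun h a ha => Prod.ext (h.1 a ha) (Prod.ext (h.2.1 a ha) (h.2.2 a ha))⟩

theorem isRad_pi_iff (hR : IsChainRingOfLengthTwo R) (w : Fin 3 → R) :
    IsRad (R := R) w ↔ ∀ i, w i ∈ Ring.jacobson R := by
  simp_rw [← isRad_ring_iff hR]
  exact ⟨fun h i a ha => congrFun (h a ha) i, fun h a ha => funext fun i => h i a ha⟩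

theorem linearIndependent_of_not_isRad (hR : IsChainRingOfLengthTwo R) {w : Fin 3 → R}
    (hw : ¬ IsRad (R := R) w) : LinearIndependent Rᵐᵒᵖ (fun _ : Fin 1 => w) := by
  rw [isRad_pi_iff hR] at hw
  push Not at hw
  obtain ⟨i, hi⟩ := hw
  rw [Fintype.linearIndependent_iff]
  intro g hg j
  have h1 := congrFun hg i
  rw [Fin.sum_univ_one] at h1
  rw [Subsingleton.elim j 0]
  exact unop_injective ((hR.isUnit_of_notMem hi).mul_right_eq_zero.1 h1)

/-- The point generated by a vector with a coordinate outside the radical. -/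
noncomputable def pointOf (hR : IsChainRingOfLengthTwo R) (w : Fin 3 → R)
    (hw : ¬ IsRad (R := R) w) : Point R :=
  ⟨Submodule.span Rᵐᵒᵖ {w}, ⟨(Module.Basis.span (linearIndependent_of_not_isRad hR hw)).map
    (LinearEquiv.ofEq _ _ (by rw [Set.range_const]))⟩⟩

theorem exists_eq_pointOf (hR : IsChainRingOfLengthTwo R) (x : Point R) :
    ∃ (w : Fin 3 → R) (hw : ¬ IsRad (R := R) w), x = pointOf hR w hw := by
  obtain ⟨M, ⟨b⟩⟩ := x
  have hw : ¬ IsRad (R := R) (b 0 : Fin 3 → R) := by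
    intro h
    obtain ⟨θ, hθ, hθ0⟩ := (Submodule.ne_bot_iff _).1 hR.radical_ne_bot
    have h1 : op θ • b 0 = 0 := Subtype.ext (h θ hθ)
    have h2 := congrArg (fun v => b.repr v 0) h1
    simp at h2
    exact hθ0 h2
  refine ⟨b 0, hw, Subtype.ext (le_antisymm (fun v hv => ?_) ?_)⟩
  · rw [pointOf, Submodule.mem_span_singleton]
    refine ⟨b.repr ⟨v, hv⟩ 0, ?_⟩
    have := congrArg Subtype.val (b.sum_repr ⟨v, hv⟩)
    simpa using this
  · exact (Submodule.span_singleton_le_iff_mem _ _).2 (b 0).2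

theorem pointOf_smul (hR : IsChainRingOfLengthTwo R) {w : Fin 3 → R} (hw : ¬ IsRad (R := R) w)
    (r : Rˣ) (hw' : ¬ IsRad (R := R) (op (r : R) • w)) :
    pointOf hR (op (r : R) • w) hw' = pointOf hR w hw :=
  Subtype.ext (Submodule.span_singleton_smul_eq r.isUnit.op w)

theorem residue_add_of_isRad (hR : IsChainRingOfLengthTwo R) {v w : Fin 3 → R}
    (h : IsRad (R := R) (v - w)) : residue R v = residue R w :=
  funext fun i => Ideal.Quotient.eq.2 ((isRad_pi_iff hR _).1 h i)

theorem isRad_of_residue_eq (hR : IsChainRingOfLengthTwo R) {v w : Fin 3 → R}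
    (h : residue R v = residue R w) : IsRad (R := R) (v - w) :=
  (isRad_pi_iff hR _).2 fun i => Ideal.Quotient.eq.1 (congrFun h i)

theorem image_residue_span_le (hR : IsChainRingOfLengthTwo R) {v w : Fin 3 → R}
    (h : IsRad (R := R) (v - w)) :
    residue R '' (Submodule.span Rᵐᵒᵖ {v} : Set (Fin 3 → R)) ⊆
      residue R '' (Submodule.span Rᵐᵒᵖ {w} : Set (Fin 3 → R)) := by
  rintro _ ⟨_, hv, rfl⟩
  obtain ⟨c, rfl⟩ := Submodule.mem_span_singleton.1 hv
  refine ⟨c • w, Submodule.mem_span_singleton.2 ⟨c, rfl⟩, (residue_add_of_isRad hR ?_).symm⟩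
  rw [← smul_sub]
  exact h.smul c

theorem pointOf_mem_neighbourClass (hR : IsChainRingOfLengthTwo R) {v w : Fin 3 → R}
    (hv : ¬ IsRad (R := R) v) (hw : ¬ IsRad (R := R) w) (h : IsRad (R := R) (v - w)) :
    pointOf hR v hv ∈ neighbourClass (pointOf hR w hw) :=
  (image_residue_span_le hR h).antisymm (image_residue_span_le hR (isRad_sub_comm h))

/-- The line `ζ = α ξ + m η` in the coordinates `(ξ, η, ζ)` given by a linear equivalence. -/
noncomputable def graphLine (φ : (Fin 3 → R) ≃ₗ[Rᵐᵒᵖ] R × R × R) (α m : R) : Line R :=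
  ⟨{ carrier := {w | (φ w).2.2 = α * (φ w).1 + m * (φ w).2.1}
     add_mem' := by
      intro v w hv hw
      simp only [Set.mem_ofPred_eq, map_add, Prod.fst_add, Prod.snd_add] at *
      rw [hv, hw]
      noncomm_ring
     zero_mem' := by simp
     smul_mem' := by
      intro c w hw
      simp only [Set.mem_ofPred_eq, map_smul, Prod.smul_fst, Prod.smul_snd] at *
      rw [hw, smul_add, mul_smul_comm, mul_smul_comm] },
    ⟨Module.Basis.ofEquivFun
      { toFun := fun w => ![op (φ w.1).1, op (φ w.1).2.1]
        map_add' := by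
          intro v w
          ext i
          fin_cases i <;> simp
        map_smul' := by
          intro c w
          ext i
          fin_cases i <;> simp [op_mul]
        invFun := fun v => ⟨φ.symm (unop (v 0), unop (v 1), α * unop (v 0) + m * unop (v 1)),
          by simp⟩
        left_inv := by
          rintro ⟨w, hw⟩
          apply Subtype.ext
          apply φ.injective
          have hw' : (φ w).2.2 = α * (φ w).1 + m * (φ w).2.1 := hw
          simp [← hw']
        right_inv := by
          intro v
          ext i
          fin_cases i <;> simp }⟩⟩

theorem pointOf_mem_graphLine (hR : IsChainRingOfLengthTwo R) {w : Fin 3 → R}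
    (hw : ¬ IsRad (R := R) w) (φ : (Fin 3 → R) ≃ₗ[Rᵐᵒᵖ] R × R × R) (α m : R) :
    pointOf hR w hw ∈ (graphLine φ α m).points ↔ (φ w).2.2 = α * (φ w).1 + m * (φ w).2.1 :=
  Submodule.span_singleton_le_iff_mem _ _

theorem not_isRad_chart (hR : IsChainRingOfLengthTwo R) (φ : (Fin 3 → R) ≃ₗ[Rᵐᵒᵖ] R × R × R)
    (s t : R) : ¬ IsRad (R := R) (φ.symm (1, s, t)) := by
  rw [isRad_map_iff, isRad_prod_iff hR]
  exact fun h => hR.notMem_of_isUnit isUnit_one h.1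

/-- The point with homogeneous coordinates `(1, s, t)`. -/
noncomputable def chart (hR : IsChainRingOfLengthTwo R) (φ : (Fin 3 → R) ≃ₗ[Rᵐᵒᵖ] R × R × R)
    (s t : R) : Point R :=
  pointOf hR (φ.symm (1, s, t)) (not_isRad_chart hR φ s t)

theorem pointOf_eq_chart (hR : IsChainRingOfLengthTwo R) {w : Fin 3 → R}
    (hw : ¬ IsRad (R := R) w) (φ : (Fin 3 → R) ≃ₗ[Rᵐᵒᵖ] R × R × R) (a : Rˣ)
    (ha : (φ w).1 = a) :
    pointOf hR w hw = chart hR φ ((φ w).2.1 * ↑a⁻¹) ((φ w).2.2 * ↑a⁻¹) := by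
  have h : op (↑a⁻¹ : R) • w = φ.symm (1, (φ w).2.1 * ↑a⁻¹, (φ w).2.2 * ↑a⁻¹) := by
    rw [LinearEquiv.eq_symm_apply, map_smul]
    ext <;> simp [ha]
  have hw' : ¬ IsRad (R := R) (op (↑a⁻¹ : R) • w) := by
    rw [h]
    exact not_isRad_chart hR φ _ _
  rw [← pointOf_smul hR hw a⁻¹ hw']
  simp only [h, chart]

theorem chart_injective (hR : IsChainRingOfLengthTwo R) (φ : (Fin 3 → R) ≃ₗ[Rᵐᵒᵖ] R × R × R)
    {s t s' t' : R} (h : chart hR φ s t = chart hR φ s' t') : s = s' ∧ t = t' := by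
  have h1 : φ.symm (1, s, t) ∈ (chart hR φ s' t').1 := by
    rw [← h]
    exact Submodule.mem_span_singleton_self _
  obtain ⟨c, hc⟩ := Submodule.mem_span_singleton.1 h1
  rw [← map_smul, φ.symm.injective.eq_iff] at hc
  obtain ⟨h0, h1, h2⟩ : c • (1 : R) = 1 ∧ c • s' = s ∧ c • t' = t := by
    simpa [Prod.ext_iff] using hc
  have hc1 : c = 1 := by
    rw [MulOpposite.smul_eq_mul_unop, one_mul] at h0
    exact unop_injective h0
  subst hc1
  simp only [one_smul] at h1 h2
  exact ⟨h1.symm, h2.symm⟩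

theorem chart_mem_graphLine (hR : IsChainRingOfLengthTwo R)
    (φ : (Fin 3 → R) ≃ₗ[Rᵐᵒᵖ] R × R × R) (s t α m : R) :
    chart hR φ s t ∈ (graphLine φ α m).points ↔ t = α + m * s := by
  rw [chart, pointOf_mem_graphLine]
  simp

theorem chart_mem_neighbourClass (hR : IsChainRingOfLengthTwo R)
    (φ : (Fin 3 → R) ≃ₗ[Rᵐᵒᵖ] R × R × R) {s t s' t' : R} (hs : s - s' ∈ Ring.jacobson R)
    (ht : t - t' ∈ Ring.jacobson R) : chart hR φ s t ∈ neighbourClass (chart hR φ s' t') := by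
  refine pointOf_mem_neighbourClass hR _ _ ?_
  rw [← map_sub, isRad_map_iff, isRad_prod_iff hR]
  simpa using ⟨hs, ht⟩

theorem pointOf_mem_neighbourClass_iff (hR : IsChainRingOfLengthTwo R) {w : Fin 3 → R}
    (hw : ¬ IsRad (R := R) w) (φ : (Fin 3 → R) ≃ₗ[Rᵐᵒᵖ] R × R × R) :
    pointOf hR w hw ∈ neighbourClass (chart hR φ 0 0) ↔
      (φ w).2.1 ∈ Ring.jacobson R ∧ (φ w).2.2 ∈ Ring.jacobson R := by
  constructor
  · intro h
    have h1 : residue R w ∈ residue R '' ((chart hR φ 0 0).1 : Set (Fin 3 → R)) := by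
      rw [← show _ = _ from h]
      exact ⟨w, Submodule.mem_span_singleton_self _, rfl⟩
    obtain ⟨v, hv, hvw⟩ := h1
    obtain ⟨c, rfl⟩ := Submodule.mem_span_singleton.1 hv
    have h2 := isRad_of_residue_eq hR hvw.symm
    rw [← isRad_map_iff φ, map_sub, map_smul, LinearEquiv.apply_symm_apply,
      isRad_prod_iff hR] at h2
    simpa using h2.2
  · intro h
    have ha : (φ w).1 ∉ Ring.jacobson R := by
      intro ha
      rw [← isRad_map_iff φ, isRad_prod_iff hR] at hw
      exact hw ⟨ha, h⟩
    obtain ⟨a, ha⟩ := hR.isUnit_of_notMem ha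
    rw [pointOf_eq_chart hR hw φ a ha.symm]
    refine chart_mem_neighbourClass hR φ ?_ ?_ <;> rw [sub_zero]
    · exact Ideal.mul_mem_right _ _ h.1
    · exact Ideal.mul_mem_right _ _ h.2

/-- Cyclically permuted coordinates, beginning with the coordinate `i`. -/
def coordFrame (R : Type*) [Ring R] (i : Fin 3) : (Fin 3 → R) ≃ₗ[Rᵐᵒᵖ] R × R × R where
  toFun w := (w i, w (i + 1), w (i + 2))
  map_add' _ _ := rfl
  map_smul' _ _ := rfl
  invFun z := fun l => if l = i then z.1 else if l = i + 1 then z.2.1 else z.2.2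
  left_inv w := by
    ext l
    fin_cases i <;> fin_cases l <;> simp
  right_inv z := by
    fin_cases i <;> simp

/-- The shear that subtracts `b` and `c` times the first coordinate from the others. -/
def shear (b c : R) : (R × R × R) ≃ₗ[Rᵐᵒᵖ] R × R × R where
  toFun z := (z.1, z.2.1 - b * z.1, z.2.2 - c * z.1)
  map_add' x y := by
    ext <;> simp [mul_add] <;> abel
  map_smul' a x := by
    ext <;> simp [mul_assoc, sub_mul]
  invFun z := (z.1, z.2.1 + b * z.1, z.2.2 + c * z.1)
  left_inv z := by simp
  right_inv z := by simp

theorem exists_frame (hR : IsChainRingOfLengthTwo R) (x : Point R) :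
    ∃ φ : (Fin 3 → R) ≃ₗ[Rᵐᵒᵖ] R × R × R, x = chart hR φ 0 0 := by
  obtain ⟨w, hw, rfl⟩ := exists_eq_pointOf hR x
  have hi := hw
  rw [isRad_pi_iff hR] at hi
  push Not at hi
  obtain ⟨i, hi⟩ := hi
  obtain ⟨a, ha⟩ := hR.isUnit_of_notMem hi
  refine ⟨(coordFrame R i).trans (shear (w (i + 1) * ↑a⁻¹) (w (i + 2) * ↑a⁻¹)), ?_⟩
  rw [pointOf_eq_chart hR hw
    ((coordFrame R i).trans (shear (w (i + 1) * ↑a⁻¹) (w (i + 2) * ↑a⁻¹))) a ha.symm]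
  congr 1 <;> simp [coordFrame, shear, ← ha]

end Geometry

/-! ### Covering by lines and the bound from a heavy class -/

section Counting

variable {R : Type*} [Ring R]

theorem neighbourClass_eq_of_mem {x y : Point R} (h : x ∈ neighbourClass y) :
    neighbourClass x = neighbourClass y := by
  have h' : residue R '' (x.1 : Set (Fin 3 → R)) = residue R '' (y.1 : Set (Fin 3 → R)) := h
  unfold neighbourClass
  rw [h']

open scoped Classical in
theorem mult_eq_sum [Fintype (Point R)] (K : Point R → ℕ) (S : Set (Point R)) :
    mult K S = ∑ x, if x ∈ S then K x else 0 := by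
  rw [mult, finsum_mem_def, finsum_eq_sum_of_fintype]
  rfl

variable [Finite R]

/-- If every point outside of `C` is on one of the given lines, then the multiset is bounded
by these lines. -/
theorem mult_univ_add_sum_le {ι : Type*} [Fintype ι] (K : Point R → ℕ) (C : Set (Point R))
    (S : ι → Set (Point R)) (h : ∀ y ∉ C, ∃ i, y ∈ S i) :
    mult K Set.univ + ∑ i, mult K (S i ∩ C) ≤ mult K C + ∑ i, mult K (S i) := by
  classical
  have := Fintype.ofFinite (Point R)
  simp only [mult_eq_sum]
  rw [Finset.sum_comm, Finset.sum_comm (s := Finset.univ (α := ι)), ← Finset.sum_add_distrib,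
    ← Finset.sum_add_distrib]
  refine Finset.sum_le_sum fun y _ => ?_
  by_cases hy : y ∈ C
  · simp [hy]
  · obtain ⟨i, hi⟩ := h y hy
    have := Finset.single_le_sum (f := fun i => if y ∈ S i then K y else 0)
      (fun _ _ => Nat.zero_le _) (Finset.mem_univ i)
    simpa [hy, hi] using this

theorem sum_le_mult {ι : Type*} [Fintype ι] (K : Point R → ℕ) (S : Set (Point R)) (g : ι → Point R)
    (hg : Function.Injective g) (hS : ∀ i, g i ∈ S) : ∑ i, K (g i) ≤ mult K S := by
  classical
  have := Fintype.ofFinite (Point R)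
  rw [mult_eq_sum, ← Finset.sum_filter, ← Finset.sum_image (f := K) (s := Finset.univ) hg.injOn]
  exact Finset.sum_le_sum_of_subset fun y => by
    simp only [Finset.mem_image, Finset.mem_filter, Finset.mem_univ, true_and]
    rintro ⟨i, rfl⟩
    exact hS i

theorem mult_le_sum {ι : Type*} [Fintype ι] (K : Point R → ℕ) (S : Set (Point R)) (g : ι → Point R)
    (hS : ∀ x ∈ S, ∃ i, g i = x) : mult K S ≤ ∑ i, K (g i) := by
  classical
  have := Fintype.ofFinite (Point R)
  rw [mult_eq_sum, ← Finset.sum_filter]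
  have h : Finset.univ.filter (· ∈ S) ⊆ Finset.univ.image g := fun x hx => by
    obtain ⟨i, rfl⟩ := hS x (by simpa using hx)
    simp
  refine (Finset.sum_le_sum_of_subset h).trans ?_
  exact Finset.sum_image_le_of_nonneg (fun _ _ => Nat.zero_le _)

theorem mult_univ_le_sum {ι : Type*} [Fintype ι] (K : Point R → ℕ) (S : ι → Set (Point R))
    (h : ∀ y, ∃ i, y ∈ S i) : mult K Set.univ ≤ ∑ i, mult K (S i) := by
  have := mult_univ_add_sum_le K ∅ S fun y _ => h y
  simpa [mult] using this

/-- There are at most `q ^ 2 + q + 1` neighbour classes of points. -/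
theorem exists_classes (hR : IsChainRingOfLengthTwo R) :
    ∃ T : ((R ⧸ Ring.jacobson R) × (R ⧸ Ring.jacobson R) ⊕ (R ⧸ Ring.jacobson R)) ⊕ Unit → Point R,
      ∀ y, ∃ i, y ∈ neighbourClass (T i) := by
  let φ := coordFrame R 0
  let ψ : (Fin 3 → R) ≃ₗ[Rᵐᵒᵖ] R × R × R := coordFrame R 1
  let χ : (Fin 3 → R) ≃ₗ[Rᵐᵒᵖ] R × R × R := coordFrame R 2
  have hout : ∀ r : R,
      r - (Ideal.Quotient.mk (Ring.jacobson R) r : R ⧸ Ring.jacobson R).out ∈ Ring.jacobson R :=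
    fun r => Ideal.Quotient.eq.1 (Quotient.out_eq' _).symm
  -- Representatives of the residue points (1, *, *), (0, 1, *) and (0, 0, 1).
  refine ⟨Sum.elim (Sum.elim (fun p => chart hR φ p.1.out p.2.out) (fun c => chart hR ψ c.out 0))
    (fun _ => chart hR χ 0 0), fun y => ?_⟩
  obtain ⟨w, hw, rfl⟩ := exists_eq_pointOf hR y
  by_cases h0 : w 0 ∈ Ring.jacobson R
  · by_cases h1 : w 1 ∈ Ring.jacobson R
    · exact ⟨Sum.inr (), (pointOf_mem_neighbourClass_iff hR hw χ).2 ⟨h0, h1⟩⟩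
    · obtain ⟨a, ha⟩ := hR.isUnit_of_notMem h1
      refine ⟨Sum.inl (Sum.inr (Ideal.Quotient.mk _ ((ψ w).2.1 * ↑a⁻¹))), ?_⟩
      rw [pointOf_eq_chart hR hw ψ a ha.symm]
      refine chart_mem_neighbourClass hR ψ (hout _) ?_
      rw [sub_zero]
      exact Ideal.mul_mem_right _ _ h0
  · obtain ⟨a, ha⟩ := hR.isUnit_of_notMem h0
    refine ⟨Sum.inl (Sum.inl (Ideal.Quotient.mk _ ((φ w).2.1 * ↑a⁻¹),
      Ideal.Quotient.mk _ ((φ w).2.2 * ↑a⁻¹))), ?_⟩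
    rw [pointOf_eq_chart hR hw φ a ha.symm]
    exact chart_mem_neighbourClass hR φ (hout _) (hout _)

variable [Fintype (R ⧸ Ring.jacobson R)]

/-- A neighbour class of large multiplicity bounds the size of an arc. -/
theorem size_le_of_large_class (hR : IsChainRingOfLengthTwo R) {K : Point R → ℕ} {k n : ℕ}
    (hK : IsArc K k n) (x : Point R)
    (hx : ((Fintype.card (R ⧸ Ring.jacobson R) : ℤ) - 1) ^ 2 < mult K (neighbourClass x)) :
    (k : ℤ) ≤ Fintype.card (R ⧸ Ring.jacobson R) * (Fintype.card (R ⧸ Ring.jacobson R) + 1) * n -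
      (Fintype.card (R ⧸ Ring.jacobson R) : ℤ) ^ 3 +
      (Fintype.card (R ⧸ Ring.jacobson R) : ℤ) ^ 2 - Fintype.card (R ⧸ Ring.jacobson R) := by
  let := hR.isField.toField
  obtain ⟨hk, hn⟩ := hK
  obtain ⟨φ, rfl⟩ := exists_frame hR x
  obtain ⟨j, hjinj, hjmem, hj⟩ := hR.exists_residue_equiv_radical
  set C := neighbourClass (chart hR φ 0 0) with hC
  have hjJ : ∀ c, j c ∈ Ring.jacobson R := fun c => (hjmem _).2 ⟨c, rfl⟩
  let f : (R ⧸ Ring.jacobson R) → (R ⧸ Ring.jacobson R) → ℕ :=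
    fun s t => K (chart hR φ (j s) (j t))
  have hcC : ∀ s t, chart hR φ (j s) (j t) ∈ C := fun s t =>
    chart_mem_neighbourClass hR φ (by simpa using hjJ s) (by simpa using hjJ t)
  have hCle : mult K C ≤ ∑ s, ∑ t, f s t := by
    rw [← Fintype.sum_prod_type']
    refine mult_le_sum K C
      (fun p : (R ⧸ Ring.jacobson R) × (R ⧸ Ring.jacobson R) => chart hR φ (j p.1) (j p.2)) fun y hy => ?_
    obtain ⟨w, hw, rfl⟩ := exists_eq_pointOf hR y
    rw [hC, pointOf_mem_neighbourClass_iff hR hw φ] at hy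
    have ha : (φ w).1 ∉ Ring.jacobson R := fun ha => by
      rw [← isRad_map_iff φ, isRad_prod_iff hR] at hw
      exact hw ⟨ha, hy⟩
    obtain ⟨a, ha⟩ := hR.isUnit_of_notMem ha
    obtain ⟨s, hs⟩ := (hjmem _).1 (Ideal.mul_mem_right (↑a⁻¹ : R) _ hy.1)
    obtain ⟨t, ht⟩ := (hjmem _).1 (Ideal.mul_mem_right (↑a⁻¹ : R) _ hy.2)
    exact ⟨(s, t), by rw [pointOf_eq_chart hR hw φ a ha.symm, ← hs, ← ht]⟩
  obtain ⟨a, b, hab⟩ := exists_lines_of_large f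
    (hx.trans_le (by exact_mod_cast hCle))
  -- Swapping the last two coordinates turns the vertical direction into a graph.
  let ψ : (Fin 3 → R) ≃ₗ[Rᵐᵒᵖ] R × R × R :=
    φ.trans ((LinearEquiv.refl Rᵐᵒᵖ R).prodCongr (LinearEquiv.prodComm Rᵐᵒᵖ R R))
  have hout : ∀ c : (R ⧸ Ring.jacobson R), Ideal.Quotient.mk (Ring.jacobson R) c.out = c :=
    Quotient.out_eq'
  let L : (R ⧸ Ring.jacobson R) × (R ⧸ Ring.jacobson R) ⊕ (R ⧸ Ring.jacobson R) → Line R := Sum.elim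
    (fun p => graphLine φ (j (a p.1)) (p.1.out + j p.2)) (fun c => graphLine ψ (j b) (j c))
  have hcover : ∀ y ∉ C, ∃ i, y ∈ (L i).points := by
    intro y hy
    obtain ⟨w, hw, rfl⟩ := exists_eq_pointOf hR y
    rw [hC, pointOf_mem_neighbourClass_iff hR hw φ] at hy
    by_cases h1 : (φ w).2.1 ∈ Ring.jacobson R
    · have h2 : (φ w).2.2 ∉ Ring.jacobson R := fun h2 => hy ⟨h1, h2⟩
      obtain ⟨v, hv⟩ := hR.isUnit_of_notMem h2
      have hm : ((φ w).2.1 - j b * (φ w).1) * ↑v⁻¹ ∈ Ring.jacobson R :=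
        Ideal.mul_mem_right _ _ (Ideal.sub_mem _ h1 (Ideal.mul_mem_right _ _ (hjJ b)))
      obtain ⟨c, hc⟩ := (hjmem _).1 hm
      refine ⟨Sum.inr c, (pointOf_mem_graphLine hR hw ψ _ _).2 ?_⟩
      change (φ w).2.1 = j b * (φ w).1 + j c * (φ w).2.2
      rw [hc, ← hv, Units.inv_mul_cancel_right, add_sub_cancel]
    · obtain ⟨v, hv⟩ := hR.isUnit_of_notMem h1
      set d : (R ⧸ Ring.jacobson R) := Ideal.Quotient.mk _ ((φ w).2.2 * ↑v⁻¹) with hd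
      have hm : ((φ w).2.2 - j (a d) * (φ w).1) * ↑v⁻¹ - d.out ∈ Ring.jacobson R := by
        rw [← Ideal.Quotient.eq, hout, hd, Ideal.Quotient.eq, sub_mul, sub_sub_cancel_left]
        exact Ideal.neg_mem_iff _ |>.2
          (Ideal.mul_mem_right _ _ (Ideal.mul_mem_right _ _ (hjJ _)))
      obtain ⟨c, hc⟩ := (hjmem _).1 hm
      refine ⟨Sum.inl (d, c), (pointOf_mem_graphLine hR hw φ _ _).2 ?_⟩
      rw [hc, add_sub_cancel, ← hv, Units.inv_mul_cancel_right, add_sub_cancel]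
  have hslope : ∀ p : (R ⧸ Ring.jacobson R) × (R ⧸ Ring.jacobson R),
      slopeSum f p.1 (a p.1) ≤ mult K ((L (Sum.inl p)).points ∩ C) := by
    intro p
    refine sum_le_mult K _ (fun s => chart hR φ (j s) (j (a p.1 + p.1 * s)))
      (fun s s' h => hjinj (chart_injective hR φ h).1) fun s => ⟨?_, hcC _ _⟩
    refine (chart_mem_graphLine hR φ _ _ _ _).2 ?_
    -- The radical part of the slope kills radical coordinates, so all q lifts contain the same
    -- affine line of the class.
    rw [add_mul, hR.radical_sq _ (hjJ _) _ (hjJ _), add_zero, ← hj, hout]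
  have hvert : ∀ c : (R ⧸ Ring.jacobson R), vertSum f b ≤ mult K ((L (Sum.inr c)).points ∩ C) := by
    intro c
    refine sum_le_mult K _ (fun t => chart hR φ (j b) (j t))
      (fun s s' h => hjinj (chart_injective hR φ h).2) fun t => ⟨?_, hcC _ _⟩
    refine (chart_mem_graphLine hR ψ _ _ _ _).2 ?_
    rw [hR.radical_sq _ (hjJ _) _ (hjJ _), add_zero]
  have hcount := mult_univ_add_sum_le K C (fun i => (L i).points) hcover
  rw [hk] at hcount
  have hupper : ∑ i, mult K (L i).points ≤
      Fintype.card (R ⧸ Ring.jacobson R) * (Fintype.card (R ⧸ Ring.jacobson R) + 1) * n := by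
    refine (Finset.sum_le_sum fun i _ => hn (L i)).trans (le_of_eq ?_)
    rw [Finset.sum_const, Finset.card_univ, Fintype.card_sum, Fintype.card_prod, smul_eq_mul]
    ring
  have hlower : Fintype.card (R ⧸ Ring.jacobson R) * (∑ m, slopeSum f m (a m) + vertSum f b) ≤
      ∑ i, mult K ((L i).points ∩ C) := by
    rw [Fintype.sum_sum_type]
    refine le_trans (le_of_eq ?_) (add_le_add (Finset.sum_le_sum fun p _ => hslope p)
      (Finset.sum_le_sum fun c _ => hvert c))
    rw [Fintype.sum_prod_type]
    simp [Finset.mul_sum, mul_add]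
  have hlower' : (Fintype.card (R ⧸ Ring.jacobson R) : ℤ) *
      ((∑ m, slopeSum f m (a m) : ℕ) + vertSum f b) ≤
      (∑ i, mult K ((L i).points ∩ C) : ℕ) := by exact_mod_cast hlower
  have hcount' : (k : ℤ) + (∑ i, mult K ((L i).points ∩ C) : ℕ) ≤
      mult K C + (∑ i, mult K (L i).points : ℕ) := by exact_mod_cast hcount
  have hupper' : ((∑ i, mult K (L i).points : ℕ) : ℤ) ≤
    Fintype.card (R ⧸ Ring.jacobson R) * (Fintype.card (R ⧸ Ring.jacobson R) + 1) * n := by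
    exact_mod_cast hupper
  have hCle' : (mult K C : ℤ) ≤ (∑ s, ∑ t, f s t : ℕ) := by exact_mod_cast hCle
  linarith

end Counting

end Hjelmslev

/-! ### Heavy class or all classes light -/

theorem mainTheorem6 {R : Type*} [Ring R] [Finite R]
    (hR : Hjelmslev.IsChainRingOfLengthTwo R)
    (q : ℕ) (hq : Nat.card (R ⧸ Ring.jacobson R) = q)
    (K : Hjelmslev.Point R → ℕ) (k n : ℕ) (hK : Hjelmslev.IsArc K k n) :
    ((q : ℤ) ^ 2 - q + 1 ≤ n → (n : ℤ) ≤ (q : ℤ) ^ 2 - 1 →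
      (k : ℤ) ≤ q * (q + 1) * n - (q : ℤ) ^ 3 + (q : ℤ) ^ 2 - q) ∧
    ((n : ℤ) = (q : ℤ) ^ 2 - q →
      (k : ℤ) ≤ (q : ℤ) ^ 4 - (q : ℤ) ^ 3 - q + 1 ∧
      ((k : ℤ) = (q : ℤ) ^ 4 - (q : ℤ) ^ 3 - q + 1 →
        ∀ x : Hjelmslev.Point R,
          (Hjelmslev.mult K (Hjelmslev.neighbourClass x) : ℤ) = ((q : ℤ) - 1) ^ 2)) := by
  have : Finite (R ⧸ Ring.jacobson R) := Finite.of_surjective _ Ideal.Quotient.mk_surjective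
  have := Fintype.ofFinite (R ⧸ Ring.jacobson R)
  rw [Nat.card_eq_fintype_card] at hq
  have hlarge := fun x hx => Hjelmslev.size_le_of_large_class hR hK x hx
  rw [hq] at hlarge
  by_cases hex : ∃ x, ((q : ℤ) - 1) ^ 2 < Hjelmslev.mult K (Hjelmslev.neighbourClass x)
  · obtain ⟨x, hx⟩ := hex
    have hk := hlarge x hx
    -- For n = q^2-q the heavy-class bound is q^4-q^3-q, one less than the claimed maximum, so
    -- equality excludes heavy classes.
    have hn : (n : ℤ) = (q : ℤ) ^ 2 - q → (k : ℤ) < (q : ℤ) ^ 4 - (q : ℤ) ^ 3 - q + 1 := by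
      intro hn
      rw [hn] at hk
      linarith
    exact ⟨fun _ _ => hk, fun h => ⟨(hn h).le, fun h' => absurd h' (hn h).ne⟩⟩
  · push Not at hex
    obtain ⟨T, hT⟩ := Hjelmslev.exists_classes hR
    have hsum : (k : ℤ) ≤ ∑ i, (Hjelmslev.mult K (Hjelmslev.neighbourClass (T i)) : ℤ) := by
      rw [← hK.1]
      exact_mod_cast Hjelmslev.mult_univ_le_sum K _ hT
    have hconst : ∑ _i : ((R ⧸ Ring.jacobson R) × (R ⧸ Ring.jacobson R) ⊕
        (R ⧸ Ring.jacobson R)) ⊕ Unit, ((q : ℤ) - 1) ^ 2 =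
          (q : ℤ) ^ 4 - (q : ℤ) ^ 3 - q + 1 := by
      simp [hq]
      ring
    have hk : (k : ℤ) ≤ (q : ℤ) ^ 4 - (q : ℤ) ^ 3 - q + 1 := by
      rw [← hconst]
      exact hsum.trans (Finset.sum_le_sum fun i _ => hex (T i))
    refine ⟨fun h _ => ?_, fun _ => ⟨hk, fun heq x => ?_⟩⟩
    · have h0 : (0 : ℤ) ≤ q * (q + 1) := by positivity
      have := mul_le_mul_of_nonneg_left h h0
      nlinarith
    · obtain ⟨i, hi⟩ := hT x
      rw [Hjelmslev.neighbourClass_eq_of_mem hi]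
      by_contra hne
      have hlt := Finset.sum_lt_sum (fun i _ => hex (T i))
        ⟨i, Finset.mem_univ i, lt_of_le_of_ne (hex (T i)) hne⟩
      rw [hconst] at hlt
      linarith
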